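/- Let $K$ be an algebraic number field with ring of integers $\mathcal O_K$. An order in $K$ is a subring $\mathcal O\subseteq\mathcal O_K$ with quotient field $K$; its conductor is the ideal $\mathfrak f=\{x\in\mathcal O_K : x\mathcal O_K\subseteq\mathcal O\}$ of $\mathcal O_K$, and $\mathcal O$ is called irreducible if exactly one prime ideal of $\mathcal O$ contains $\mathfrak f$. Proposition 4.4. Let $\mathcal O$ be an irreducible order in $K$ with conductor $\mathfrak f=\mathfrak P^k$, where $\mathfrak P$ is a prime ideal of $\mathcal O_K$ and $k\ge 1$ is an integer. Put $\mathfrak p=\mathfrak P\cap\mathcal O$, let $\mathcal O_{\mathfrak p}$ be the localization of $\mathcal O$ at $\mathfrak p$, and let $(\mathcal O_K)_{\mathfrak p}=\mathcal O_K\cdot(\mathcal O\setminus\mathfrak p)^{-1}$, which is a discrete valuation ring. For a prime element $p$ of $(\mathcal O_K)_{\mathfrak p}$ let $\mathsf v_p$ be the $p$-adic valuation, and let $\mathcal A(\mathcal O_{\mathfrak p})$ be the set of irreducible elements of $\mathcal O_{\mathfrak p}$. Suppose that (i) $|\mathrm{Pic}(\mathcal O_K)|\le 2$; (ii) $\mathcal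 O\cdot\mathcal O_K^\times=\mathcal O_K$, i.e. every element of $\mathcal O_K$ is the product of an element of $\mathcal O$ and a unit of $\mathcal O_K$; (iii) $k\le 4$ and $\mathsf v_p(\mathcal A(\mathcal O_{\mathfrak p}))\subseteq\{1,2\}$ for every prime element $p$ of $(\mathcal O_K)_{\mathfrak p}$; and if $\mathfrak P$ is principal, then $k\le 2$ and $\mathsf v_p(\mathcal A(\mathcal O_{\mathfrak p}))=\{1\}$ for every such $p$. Then $\mathcal O$ is half-factorial: every nonzero nonunit of $\mathcal O$ is a product of irreducible elements of $\mathcal O$, and any two factorizations of it into irreducible elements have the same number of factors. -/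

import Mathlib

open NumberField
open scoped Pointwise

/-- The set of lengths `L(a)` of a nonunit `a` of a commutative monoid or ring: the
numbers of factors in the factorizations of `a` into irreducible elements, counted with
multiplicity. (For units the usual convention `L(a) = {0}` is irrelevant below, since only
nonzero nonunits are considered.) -/
def setOfLengths {R : Type*} [CommMonoid R] (a : R) : Set ℕ :=
  {n | ∃ s : Multiset R, (∀ b ∈ s, Irreducible b) ∧ s.prod = a ∧ s.card = n}

/-- An integral domain is half-factorial if every nonzero nonunit is a product of irreducible
elements and all its factorizations into irreducible elements have the same length,
i.e. `|L(a)| = 1`. -/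
def IsHalfFactorial (R : Type*) [CommRing R] [IsDomain R] : Prop :=
  ∀ a : R, a ≠ 0 → ¬ IsUnit a → ∃! n : ℕ, n ∈ setOfLengths a

/-- A subring `O` of the ring of integers of `K` is an order in `K` if `K` is its quotient
field. -/
def IsNumberFieldOrder {K : Type*} [Field K] [NumberField K] (O : Subring (𝓞 K)) : Prop :=
  IsFractionRing O K

/-- The conductor `{x ∈ 𝓞 K | x 𝓞 K ⊆ O}` of `O`, an ideal of `𝓞 K` contained in `O`. -/
def orderConductor {K : Type*} [Field K] [NumberField K] (O : Subring (𝓞 K)) :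
    Ideal (𝓞 K) where
  carrier := {x | ∀ y : 𝓞 K, x * y ∈ O}
  add_mem' := fun {a b} ha hb y => by
    rw [add_mul]
    exact O.add_mem (ha y) (hb y)
  zero_mem' := fun y => by
    rw [zero_mul]
    exact O.zero_mem
  smul_mem' := fun c x hx y => by
    have h : (c • x) * y = x * (c * y) := by
      rw [smul_eq_mul]
      ring
    rw [h]
    exact hx (c * y)

/-- `O` is irreducible if exactly one prime ideal of `O` contains the conductor. -/
def IsIrreducibleOrder {K : Type*} [Field K] [NumberField K] (O : Subring (𝓞 K)) : Prop :=
  ∃! 𝔭 : Ideal O, 𝔭.IsPrime ∧ (orderConductor O).comap O.subtype ≤ 𝔭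

/-- The prime ideal `𝔭 = P ∩ O` of `O` below a prime ideal `P` of `𝓞 K`. -/
abbrev primeBelow {K : Type*} [Field K] [NumberField K] (O : Subring (𝓞 K))
    (P : Ideal (𝓞 K)) : Ideal O :=
  P.comap O.subtype

/-- The local order `O_𝔭`, with `𝔭 = P ∩ O`. -/
abbrev LocalOrder {K : Type*} [Field K] [NumberField K] (O : Subring (𝓞 K))
    (P : Ideal (𝓞 K)) [P.IsPrime] : Type _ :=
  Localization (primeBelow O P).primeCompl

/-- The overring `(𝓞 K)_𝔭 = 𝓞 K · (O ∖ 𝔭)⁻¹` of `O_𝔭`, with `𝔭 = P ∩ O`. -/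
abbrev LocalOverring {K : Type*} [Field K] [NumberField K] (O : Subring (𝓞 K))
    (P : Ideal (𝓞 K)) [P.IsPrime] : Type _ :=
  Localization (Algebra.algebraMapSubmonoid (𝓞 K) (primeBelow O P).primeCompl)

/-- The set `v_p(𝒜(O_𝔭))` of the `p`-adic valuations of the irreducible elements of `O_𝔭`, where
`𝔭 = P ∩ O` and `p` is an element of `(𝓞 K)_𝔭`: the valuation of `a` is the largest `n` such that
`p ^ n` divides `a` in `(𝓞 K)_𝔭`. -/
noncomputable def atomValuations {K : Type*} [Field K] [NumberField K] (O : Subring (𝓞 K))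
    (P : Ideal (𝓞 K)) [P.IsPrime] (p : LocalOverring O P) : Set ℕ∞ :=
  (fun a : LocalOrder O P =>
    emultiplicity p (algebraMap (LocalOrder O P) (LocalOverring O P) a)) '' {a | Irreducible a}

/-! Give each prime ideal of `𝓞 K` weight 2 if it is principal and 1 otherwise, and extend
additively to nonzero ideals. If every atom of `O` generates an ideal of weight 2, then every
factorization of `a` into atoms has length half the weight of `a 𝓞 K`. Existence of factorizations
is Noetherianity.

For an atom `a`, the key fact is that certain proper principal ideals `J` dividing `a 𝓞 K` must
equal it. If `J` is prime to `P`, then (ii) gives a generator in `O` outside `P`, and irreducibility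
of the order puts the cofactor in `O` (`span_eq_of_irreducible_of_dvd`). If `J = P ^ d`, with `d =
1` for principal `P` and `d = 2` otherwise, then (iii) gives a divisor of valuation `d` in the local
order, and (ii) makes it global (`exists_mul_eq_of_mem_pow`). This settles atoms with a principal
prime factor. Otherwise, by (i), two prime factors have principal product. Among three factors, two
are both `P` or both different from `P`, and their product is such a `J`. So exactly two
nonprincipal primes occur. -/

section

variable {K : Type*} [Field K] [NumberField K] {O : Subring (𝓞 K)} {P : Ideal (𝓞 K)}

/-! ### Cancellation, units and chain conditions in the order. -/

/-- In an irreducible order, an element outside the prime `P` above the conductor can be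
cancelled from membership in the order. -/
theorem mem_order_of_mul_mem (hirr : IsIrreducibleOrder O) [P.IsPrime]
    (hc : orderConductor O ≤ P) {s : O} (hs : (s : 𝓞 K) ∉ P) {x : 𝓞 K}
    (h : (s : 𝓞 K) * x ∈ O) : x ∈ O := by
  -- A maximal ideal containing the conductor is `P ∩ O`, which misses `s`.
  have htop : Ideal.span {s} ⊔ (orderConductor O).comap O.subtype = ⊤ := by
    by_contra hne
    obtain ⟨m, hm, hle⟩ := Ideal.exists_le_maximal _ hne
    have hmP : m = primeBelow O P :=
      hirr.unique ⟨hm.isPrime, le_sup_right.trans hle⟩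
        ⟨inferInstance, Ideal.comap_mono hc⟩
    have hsm : s ∈ m := hle (le_sup_left (α := Ideal O) (Ideal.mem_span_singleton_self s))
    rw [hmP] at hsm
    exact hs hsm
  have h1 : (1 : O) ∈ Ideal.span {s} ⊔ (orderConductor O).comap O.subtype := by
    rw [htop]; trivial
  obtain ⟨y, hy, z, hz, hyz⟩ := Submodule.mem_sup.1 h1
  obtain ⟨c, rfl⟩ := Ideal.mem_span_singleton'.1 hy
  have hzx : (z : 𝓞 K) * x ∈ O := hz x
  have hyz' : (c : 𝓞 K) * s + z = 1 := by exact_mod_cast congrArg Subtype.val hyz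
  have hx : x = c * (s * x) + z * x := by linear_combination (-x) * hyz'
  rw [hx]
  exact O.add_mem (O.mul_mem c.2 h) hzx

theorem isUnit_order_of_isUnit (hirr : IsIrreducibleOrder O) [P.IsPrime]
    (hc : orderConductor O ≤ P) {a : O} (ha : IsUnit (a : 𝓞 K)) : IsUnit a := by
  obtain ⟨b, hb⟩ := ha.exists_right_inv
  have haP : (a : 𝓞 K) ∉ P := fun h => (inferInstance : P.IsPrime).ne_top
    (Ideal.eq_top_of_isUnit_mem _ h ha)
  have hbO : b ∈ O := mem_order_of_mul_mem hirr hc haP (hb ▸ O.one_mem)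
  exact IsUnit.of_mul_eq_one ⟨b, hbO⟩ (Subtype.ext hb)

/-- `O` is a subgroup of the finitely generated abelian group `𝓞 K`. -/
theorem isNoetherianRing_order (O : Subring (𝓞 K)) : IsNoetherianRing O := by
  let M : Submodule ℤ (𝓞 K) := AddSubgroup.toIntSubmodule O.toAddSubgroup
  have hM : IsNoetherian ℤ M := inferInstance
  have e : IsNoetherian ℤ O := hM
  exact isNoetherian_of_tower ℤ e

/-! ### Principal ideals and the class group. -/

/-- A product of two nonprincipal ideals is principal if the Picard group has order at most 2. -/
theorem isPrincipal_mul_of_card_pic_le_two {R : Type*} [CommRing R] [IsDedekindDomain R]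
    [Fintype (ClassGroup R)] (h : Nat.card (CommRing.Pic R) ≤ 2) {I J : Ideal R}
    (hI : ¬ Submodule.IsPrincipal I) (hJ : ¬ Submodule.IsPrincipal J) :
    Submodule.IsPrincipal (I * J) := by
  classical
  have hI0 : I ∈ nonZeroDivisors (Ideal R) :=
    mem_nonZeroDivisors_of_ne_zero fun h => hI (by rw [h]; exact bot_isPrincipal)
  have hJ0 : J ∈ nonZeroDivisors (Ideal R) :=
    mem_nonZeroDivisors_of_ne_zero fun h => hJ (by rw [h]; exact bot_isPrincipal)
  rw [← Nat.card_congr (ClassGroup.equivPic R).toEquiv, Nat.card_eq_fintype_card] at h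
  by_contra hIJ
  rw [← ClassGroup.mk0_eq_one_iff hI0] at hI
  rw [← ClassGroup.mk0_eq_one_iff hJ0] at hJ
  have hIJ0 : I * J ∈ nonZeroDivisors (Ideal R) := Submonoid.mul_mem _ hI0 hJ0
  rw [← ClassGroup.mk0_eq_one_iff hIJ0] at hIJ
  set x := ClassGroup.mk0 ⟨I, hI0⟩
  set y := ClassGroup.mk0 ⟨J, hJ0⟩
  have hxy : ClassGroup.mk0 ⟨I * J, hIJ0⟩ = x * y := by
    rw [← map_mul, Submonoid.mk_mul_mk]
  rw [hxy] at hIJ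
  -- If `x` and `x * y` were nontrivial along with `y`, there would be three distinct classes.
  have hcard : ({1, x, x * y} : Finset (ClassGroup R)).card = 3 := by
    refine Finset.card_eq_three.2 ⟨1, x, x * y, Ne.symm hI, Ne.symm hIJ, ?_, rfl⟩
    simpa using hJ
  have := Finset.card_le_univ ({1, x, x * y} : Finset (ClassGroup R))
  omega

theorem isPrincipal_of_isPrincipal_mul {R : Type*} [CommRing R] [IsDedekindDomain R]
    {I J : Ideal R} (hI : Submodule.IsPrincipal I)
    (hI0 : I ≠ ⊥) (hIJ : Submodule.IsPrincipal (I * J)) : Submodule.IsPrincipal J := by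
  obtain ⟨x, rfl⟩ := hI
  obtain ⟨y, hy⟩ := hIJ
  change Ideal.span {x} * J = Ideal.span {y} at hy
  have hx : x ≠ 0 := by rintro rfl; simp at hI0
  have hyx : y ∈ Ideal.span {x} :=
    Ideal.dvd_span_singleton.1 ⟨J, hy.symm⟩
  obtain ⟨z, rfl⟩ := Ideal.mem_span_singleton.1 hyx
  rw [← Ideal.span_singleton_mul_span_singleton] at hy
  exact ⟨z, mul_left_cancel₀ (a := Ideal.span {x}) (by simpa using hx) hy⟩

/-! ### Valuations, atoms and localization at `P`. -/

/-- A divisor of valuation 2 can be found below an element of valuation at least 2, provided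
all atoms have valuation 1 or 2. -/
theorem exists_dvd_of_atom_valuation_mem {R : Type*} [CommRing R] [IsDomain R] [WfDvdMonoid R]
    (v : R → ℕ∞) (hmul : ∀ x y, v (x * y) = v x + v y) (hunit : ∀ x, IsUnit x → v x = 0)
    (hat : ∀ x, Irreducible x → v x = 1 ∨ v x = 2) {a : R} (ha : a ≠ 0) (hv : 2 ≤ v a) :
    ∃ b, b ∣ a ∧ v b = 2 := by
  have hex : ∀ c : R, c ≠ 0 → v c ≠ 0 → ∃ x, Irreducible x ∧ x ∣ c := fun c hc h0 =>
    WfDvdMonoid.exists_irreducible_factor (fun hu => h0 (hunit c hu)) hc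
  obtain ⟨x, hx, c, rfl⟩ := hex a ha (by rintro h; simp [h] at hv)
  rcases hat x hx with h1 | h2
  · have hvc : v c ≠ 0 := by
      intro h
      rw [hmul, h1, h] at hv
      exact absurd hv (by norm_num)
    obtain ⟨y, hy, e, rfl⟩ := hex c (right_ne_zero_of_mul ha) hvc
    rcases hat y hy with h1' | h2
    · exact ⟨x * y, ⟨e, by ring⟩, by rw [hmul, h1, h1']; norm_num⟩
    · exact ⟨y, ⟨x * e, by ring⟩, h2⟩
  · exact ⟨x, ⟨c, rfl⟩, h2⟩

theorem algebraMap_localOrder_apply [P.IsPrime] (x : O) :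
    algebraMap (LocalOrder O P) (LocalOverring O P) (algebraMap O (LocalOrder O P) x) =
      algebraMap (𝓞 K) (LocalOverring O P) (x : 𝓞 K) := by
  rw [← IsScalarTower.algebraMap_apply O (LocalOrder O P) (LocalOverring O P)]
  rw [IsScalarTower.algebraMap_apply O (𝓞 K) (LocalOverring O P)]
  rfl

theorem primeCompl_map_le (O : Subring (𝓞 K)) (P : Ideal (𝓞 K)) [P.IsPrime] :
    Algebra.algebraMapSubmonoid (𝓞 K) (primeBelow O P).primeCompl ≤ nonZeroDivisors (𝓞 K) := by
  rintro _ ⟨x, hx, rfl⟩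
  refine mem_nonZeroDivisors_of_ne_zero fun h => hx ?_
  change (x : 𝓞 K) ∈ P
  change (x : 𝓞 K) = 0 at h
  rw [h]; exact P.zero_mem

instance [P.IsPrime] : IsDomain (LocalOverring O P) :=
  IsLocalization.isDomain_localization (primeCompl_map_le O P)

/-- An element generating `P` locally at `P`: the `P`-adic valuation is the valuation with
respect to a prime element of the overring. -/
theorem exists_prime_localOverring [P.IsPrime] (hP : P ≠ ⊥) {k : ℕ}
    (hf : orderConductor O = P ^ k) :
    ∃ p : LocalOverring O P, Prime p ∧ ∀ (n : ℕ) (x : 𝓞 K),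
      p ^ n ∣ algebraMap (𝓞 K) (LocalOverring O P) x ↔ x ∈ P ^ n := by
  have hPt : P ≠ ⊤ := Ideal.IsPrime.ne_top inferInstance
  have hmax : P.IsMaximal := Ideal.IsPrime.isMaximal inferInstance hP
  obtain ⟨t, ht, ht2⟩ := Ideal.exists_mem_pow_notMem_pow_succ P hP hPt 1
  rw [pow_one] at ht
  obtain ⟨J, hJ⟩ := Ideal.dvd_iff_le.2 ((Ideal.span_singleton_le_iff_mem P).2 ht)
  have hJP : ¬ J ≤ P := fun h => ht2 (by
    rw [← Ideal.span_singleton_le_iff_mem, hJ, pow_succ, pow_one]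
    exact Ideal.mul_mono_right h)
  have ht0 : t ≠ 0 := by rintro rfl; exact ht2 (zero_mem _)
  -- Write `1 = j + c` with `j ∈ J ^ n` and `c ∈ P ^ (k + 1)`. Then `c` lies in the conductor, so `j
  -- ∈ O`, and `j ≡ 1` modulo `P`. The exponent `k + 1` keeps `c` in `P` even for `k = 0`.
  have hS : ∀ n : ℕ, ∃ s : O, (s : 𝓞 K) ∈ J ^ n ∧ (s : 𝓞 K) ∉ P := by
    intro n
    have hcop : IsCoprime (J ^ n) (P ^ (k + 1)) := by
      refine IsCoprime.pow (Ideal.isCoprime_iff_codisjoint.2 ?_)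
      exact codisjoint_iff.2 (sup_comm J P ▸ hmax.1.2 _ (left_lt_sup.2 hJP))
    obtain ⟨j, hj, c, hcf, hjc⟩ := Ideal.isCoprime_iff_exists.1 hcop
    have hcO : c ∈ O := by
      have h : c ∈ orderConductor O := hf ▸ Ideal.pow_le_pow_right (Nat.le_succ k) hcf
      simpa using h 1
    have hjO : j ∈ O := by
      rw [eq_sub_of_add_eq hjc]
      exact O.sub_mem O.one_mem hcO
    refine ⟨⟨j, hjO⟩, hj, fun hjP => hPt ?_⟩
    rw [Ideal.eq_top_iff_one, ← hjc]
    exact P.add_mem hjP (Ideal.pow_le_self k.succ_ne_zero hcf)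
  set M := Algebra.algebraMapSubmonoid (𝓞 K) (primeBelow O P).primeCompl
  have hunit : ∀ s : O, (s : 𝓞 K) ∉ P →
      IsUnit (algebraMap (𝓞 K) (LocalOverring O P) (s : 𝓞 K)) := fun s hs =>
    IsLocalization.map_units (M := M) _ ⟨_, ⟨s, hs, rfl⟩⟩
  have hdvd : ∀ y x : 𝓞 K, algebraMap (𝓞 K) (LocalOverring O P) y ∣
      algebraMap (𝓞 K) (LocalOverring O P) x ↔ ∃ s : O, (s : 𝓞 K) ∉ P ∧ y ∣ s * x := by
    intro y x
    constructor
    · rintro ⟨z, hz⟩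
      obtain ⟨z', ⟨_, s, hs, rfl⟩, rfl⟩ := IsLocalization.exists_mk'_eq M z
      refine ⟨s, hs, z', ?_⟩
      apply IsLocalization.injective (LocalOverring O P) (M := M) (primeCompl_map_le O P)
      rw [map_mul, hz, map_mul]
      rw [← IsLocalization.mk'_spec (LocalOverring O P) z' (⟨_, s, hs, rfl⟩ : M)]
      change algebraMap (𝓞 K) (LocalOverring O P) (s : 𝓞 K) * _ =
        _ * (_ * algebraMap (𝓞 K) (LocalOverring O P) (s : 𝓞 K))
      ring
    · rintro ⟨s, hs, h⟩
      have := map_dvd (algebraMap (𝓞 K) (LocalOverring O P)) h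
      rw [map_mul] at this
      exact (hunit s hs).dvd_mul_left.1 this
  have key : ∀ (n : ℕ) (x : 𝓞 K), (algebraMap (𝓞 K) (LocalOverring O P) t) ^ n ∣
      algebraMap (𝓞 K) (LocalOverring O P) x ↔ x ∈ P ^ n := by
    intro n x
    rw [← map_pow, hdvd]
    constructor
    · rintro ⟨s, hs, h⟩
      exact (Ideal.IsPrime.mul_mem_pow P
        (Ideal.mem_of_dvd _ h (Ideal.pow_mem_pow ht n))).resolve_left hs
    · intro hx
      -- Since `(t) = P * J`, multiplying `x ∈ P ^ n` by `s ∈ J ^ n` gives a multiple of `t ^ n`,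
      -- and `s` is a local unit.
      obtain ⟨s, hs, hsP⟩ := hS n
      refine ⟨s, hsP, ?_⟩
      rw [← Ideal.mem_span_singleton, ← Ideal.span_singleton_pow, hJ, mul_pow, mul_comm (s : 𝓞 K)]
      exact Ideal.mul_mem_mul hx hs
  have key1 : ∀ x : 𝓞 K, algebraMap (𝓞 K) (LocalOverring O P) t ∣
      algebraMap (𝓞 K) (LocalOverring O P) x ↔ x ∈ P := by
    intro x
    simpa using key 1 x
  refine ⟨_, ⟨?_, ?_, ?_⟩, key⟩
  · intro h
    apply ht0
    apply IsLocalization.injective (LocalOverring O P) (M := M) (primeCompl_map_le O P)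
    rw [h, map_zero]
  · intro h
    refine hPt ((Ideal.eq_top_iff_one _).2 ((key1 1).1 ?_))
    exact h.dvd
  · have hmk : ∀ a s, Associated (IsLocalization.mk' (LocalOverring O P) a s)
        (algebraMap (𝓞 K) (LocalOverring O P) a) := fun a (s : M) =>
      ⟨(IsLocalization.map_units (LocalOverring O P) s).unit, IsLocalization.mk'_spec _ a s⟩
    intro a b hab
    obtain ⟨a, s, rfl⟩ := IsLocalization.exists_mk'_eq M a
    obtain ⟨b, r, rfl⟩ := IsLocalization.exists_mk'_eq M b
    rw [← IsLocalization.mk'_mul, (hmk _ _).dvd_iff_dvd_right, key1] at hab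
    rw [(hmk _ _).dvd_iff_dvd_right, key1, (hmk _ _).dvd_iff_dvd_right, key1]
    exact (inferInstance : P.IsPrime).mem_or_mem hab

/-- In the local order, an element of `P`-adic valuation greater than `d` has a divisor of
valuation `d`; globally it splits off a generator of `P ^ d` lying in the order. -/
theorem exists_mul_eq_of_mem_pow (hirr : IsIrreducibleOrder O) [P.IsPrime] (hP : P ≠ ⊥)
    {k : ℕ} (hk : 0 < k) (hf : orderConductor O = P ^ k)
    (hu : (O : Set (𝓞 K)) * Set.range (fun u : (𝓞 K)ˣ => (u : 𝓞 K)) = Set.univ)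
    {d : ℕ} (hd : (P ^ d).IsPrincipal)
    (hat : ∀ p : LocalOverring O P, Prime p →
      d = 1 ∧ atomValuations O P p = {1} ∨ d = 2 ∧ atomValuations O P p ⊆ {1, 2})
    {a : O} (ha : a ≠ 0) (hmem : (a : 𝓞 K) ∈ P ^ d) :
    ∃ b c : O, a = b * c ∧ Ideal.span {(b : 𝓞 K)} = P ^ d := by
  have hc : orderConductor O ≤ P := hf ▸ Ideal.pow_le_self hk.ne'
  obtain ⟨p, hp, hval⟩ := exists_prime_localOverring hP hf
  have hle : (primeBelow O P).primeCompl ≤ nonZeroDivisors O := by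
    intro x hx
    refine mem_nonZeroDivisors_of_ne_zero ?_
    rintro rfl
    exact hx (zero_mem _)
  have : IsDomain (LocalOrder O P) := IsLocalization.isDomain_localization hle
  have : IsNoetherianRing O := isNoetherianRing_order O
  have : IsNoetherianRing (LocalOrder O P) :=
    IsLocalization.isNoetherianRing (primeBelow O P).primeCompl _ inferInstance
  have hinj : Function.Injective (algebraMap O (LocalOrder O P)) :=
    IsLocalization.injective _ hle
  let v : LocalOrder O P → ℕ∞ := fun x =>
    emultiplicity p (algebraMap (LocalOrder O P) (LocalOverring O P) x)
  have hmul : ∀ x y, v (x * y) = v x + v y := fun x y => by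
    simp only [v, map_mul, emultiplicity_mul hp]
  have hunit : ∀ x, IsUnit x → v x = 0 := fun x hx =>
    emultiplicity_eq_zero.2 fun h => hp.not_isUnit (isUnit_of_dvd_unit h (hx.map _))
  have hv : ∀ (n : ℕ) (x : O), (n : ℕ∞) ≤ v (algebraMap O _ x) ↔ (x : 𝓞 K) ∈ P ^ n := by
    intro n x
    rw [← hval, ← algebraMap_localOrder_apply]
    exact pow_dvd_iff_le_emultiplicity.symm
  have ha0 : algebraMap O (LocalOrder O P) a ≠ 0 := fun h => ha (hinj (by rw [h, map_zero]))
  have hb : ∃ b, b ∣ algebraMap O (LocalOrder O P) a ∧ v b = d := by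
    have hva := (hv d a).2 hmem
    have hmemv : ∀ x, Irreducible x → v x ∈ atomValuations O P p := fun x hx => ⟨x, hx, rfl⟩
    rcases hat p hp with ⟨rfl, h1⟩ | ⟨rfl, h2⟩
    · have hnu : ¬ IsUnit (algebraMap O (LocalOrder O P) a) := fun h => by
        rw [hunit _ h] at hva
        exact absurd hva (by norm_num)
      obtain ⟨x, hx, hxa⟩ := WfDvdMonoid.exists_irreducible_factor hnu ha0
      have := hmemv x hx
      rw [h1] at this
      exact ⟨x, hxa, by simpa using this⟩
    · exact exists_dvd_of_atom_valuation_mem v hmul hunit (fun x hx => h2 (hmemv x hx)) ha0 hva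
  obtain ⟨b, hba, hvb⟩ := hb
  obtain ⟨b, s, rfl⟩ := IsLocalization.exists_mk'_eq (primeBelow O P).primeCompl b
  have hass : Associated (IsLocalization.mk' (LocalOrder O P) b s) (algebraMap O _ b) :=
    ⟨(IsLocalization.map_units (LocalOrder O P) s).unit, IsLocalization.mk'_spec _ b s⟩
  obtain ⟨e, he⟩ := hba
  have hvb' : v (algebraMap O _ b) = d := by
    rw [← IsLocalization.mk'_spec (LocalOrder O P) b s, hmul, hvb,
      hunit _ (IsLocalization.map_units _ s), add_zero]
  have hbm : (b : 𝓞 K) ∈ P ^ d := (hv d b).1 hvb'.ge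
  have hbm' : (b : 𝓞 K) ∉ P ^ (d + 1) := fun h => by
    have := (hv (d + 1) b).2 h
    rw [hvb', Nat.cast_le] at this
    omega
  obtain ⟨π, hπ⟩ := hd
  change P ^ d = Ideal.span {π} at hπ
  have hπ0 : π ≠ 0 := by
    rintro rfl
    exact pow_ne_zero d hP (by simpa using hπ)
  rw [hπ] at hbm
  obtain ⟨j, hj⟩ := Ideal.mem_span_singleton.1 hbm
  have hjP : j ∉ P := fun h => hbm' (by
    rw [hj, pow_succ]
    exact Ideal.mul_mem_mul (hπ.ge (Ideal.mem_span_singleton_self π)) h)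
  -- By (ii) the part of `b` prime to `P` is `j * u` with `j ∈ O` and `u` a unit. Cancelling `j`
  -- from `b = j * (π * u)` leaves the generator `π * u` of `P ^ d` in `O`.
  obtain ⟨j, hjO, _, ⟨u, rfl⟩, rfl⟩ : j ∈ (O : Set (𝓞 K)) * Set.range
    (fun u : (𝓞 K)ˣ => (u : 𝓞 K)) := hu ▸ Set.mem_univ j
  replace hjP : j ∉ P := fun h => hjP (P.mul_mem_right _ h)
  have hβO : π * u ∈ O := by
    refine mem_order_of_mul_mem hirr hc (s := ⟨j, hjO⟩) hjP ?_
    convert b.2 using 1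
    rw [hj]
    ring
  rw [hπ] at hmem
  obtain ⟨g, hg⟩ := Ideal.mem_span_singleton.1 hmem
  have hspan : Ideal.span {π * (u : 𝓞 K)} = P ^ d := by
    rw [hπ]
    exact Ideal.span_singleton_mul_right_unit u.isUnit π
  -- Clearing denominators in the local divisibility gives `a * r = b * y` with `r ∉ P`. Dividing by
  -- `π * u` yields `r * (u⁻¹ * g) = j * y ∈ O`, and `r` cancels.
  have hgO : (↑u⁻¹ : 𝓞 K) * g ∈ O := by
    have hdvd : algebraMap O (LocalOrder O P) b ∣ algebraMap O (LocalOrder O P) a :=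
      hass.symm.dvd.trans ⟨e, he⟩
    obtain ⟨w, hw⟩ := hdvd
    obtain ⟨y, r, rfl⟩ := IsLocalization.exists_mk'_eq (primeBelow O P).primeCompl w
    have hy : a * r = b * y := by
      apply hinj
      rw [map_mul, map_mul, hw, mul_assoc, IsLocalization.mk'_spec]
    refine mem_order_of_mul_mem hirr hc (s := r) r.2 ?_
    have hy' : (a : 𝓞 K) * (r : O) = b * y := congrArg Subtype.val hy
    convert O.mul_mem hjO y.2 using 1
    apply mul_left_cancel₀ hπ0
    apply mul_left_cancel₀ u.ne_zero
    have huu := u.mul_inv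
    rw [hg, hj] at hy'
    linear_combination hy' + π * g * (r : O) * huu
  refine ⟨⟨π * u, hβO⟩, ⟨_, hgO⟩, Subtype.ext ?_, hspan⟩
  change (a : 𝓞 K) = π * u * (↑u⁻¹ * g)
  rw [hg]
  linear_combination (-π * g) * u.mul_inv

/-! ### The weight of an ideal. -/

open UniqueFactorizationMonoid in
open scoped Classical in
/-- Twice the length function: each principal prime factor counts 2, each nonprincipal one 1. -/
noncomputable def primeWeight {R : Type*} [CommRing R] [IsDedekindDomain R] (I : Ideal R) : ℕ :=
  ((normalizedFactors I).map fun Q => if Submodule.IsPrincipal Q then 2 else 1).sum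

section primeWeight

open UniqueFactorizationMonoid

variable {R : Type*} [CommRing R] [IsDedekindDomain R]

theorem primeWeight_mul {I J : Ideal R} (hI : I ≠ 0) (hJ : J ≠ 0) :
    primeWeight (I * J) = primeWeight I + primeWeight J := by
  rw [primeWeight, normalizedFactors_mul hI hJ, Multiset.map_add, Multiset.sum_add]
  rfl

theorem primeWeight_one : primeWeight (1 : Ideal R) = 0 := by
  simp [primeWeight, normalizedFactors_one, -Ideal.one_eq_top]

theorem primeWeight_of_prime_of_isPrincipal {Q : Ideal R} (hQ : Prime Q)
    (h : Submodule.IsPrincipal Q) : primeWeight Q = 2 := by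
  simp [primeWeight, normalizedFactors_irreducible hQ.irreducible, h]

theorem primeWeight_of_prime_of_not_isPrincipal {Q : Ideal R} (hQ : Prime Q)
    (h : ¬ Submodule.IsPrincipal Q) : primeWeight Q = 1 := by
  simp [primeWeight, normalizedFactors_irreducible hQ.irreducible, h]

end primeWeight

/-! ### Atoms of the order have weight 2. -/

/-- An atom of the order divisible in the maximal order by a principal ideal prime to the
conductor generates that ideal. -/
theorem span_eq_of_irreducible_of_dvd (hirr : IsIrreducibleOrder O) [P.IsPrime]
    (hc : orderConductor O ≤ P)
    (hu : (O : Set (𝓞 K)) * Set.range (fun u : (𝓞 K)ˣ => (u : 𝓞 K)) = Set.univ)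
    {a : O} (ha : Irreducible a) {J : Ideal (𝓞 K)} (hJ : Submodule.IsPrincipal J)
    (hJt : J ≠ ⊤) (hJP : ¬ J ≤ P) (hdvd : J ∣ Ideal.span {(a : 𝓞 K)}) :
    Ideal.span {(a : 𝓞 K)} = J := by
  obtain ⟨j, hj⟩ := hJ
  change J = Ideal.span {j} at hj
  obtain ⟨j, hjO, _, ⟨u, rfl⟩, rfl⟩ : j ∈ (O : Set (𝓞 K)) * Set.range
    (fun u : (𝓞 K)ˣ => (u : 𝓞 K)) := hu ▸ Set.mem_univ j
  have hj' : J = Ideal.span {j} := by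
    rw [hj]
    exact Ideal.span_singleton_mul_right_unit u.isUnit j
  subst hj'
  have hjP : j ∉ P := fun h => hJP ((Ideal.span_singleton_le_iff_mem P).2 h)
  obtain ⟨b, hb⟩ := Ideal.mem_span_singleton.1 (Ideal.dvd_span_singleton.1 hdvd)
  have hbO : b ∈ O := mem_order_of_mul_mem hirr hc (s := ⟨j, hjO⟩) hjP (by
    change j * b ∈ O
    rw [← hb]
    exact a.2)
  have hab : a = ⟨j, hjO⟩ * ⟨b, hbO⟩ := Subtype.ext hb
  rcases ha.isUnit_or_isUnit hab with h | h
  · exact absurd (Ideal.span_singleton_eq_top.2 (h.map O.subtype)) hJt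
  · rw [hb]
    exact Ideal.span_singleton_mul_right_unit (h.map O.subtype) j

/-- Every atom of the order has weight 2. -/
theorem primeWeight_of_irreducible (hirr : IsIrreducibleOrder O) [P.IsPrime] (hP : P ≠ ⊥)
    {k : ℕ} (hk : 0 < k) (hf : orderConductor O = P ^ k)
    (hpic : Nat.card (CommRing.Pic (𝓞 K)) ≤ 2)
    (hu : (O : Set (𝓞 K)) * Set.range (fun u : (𝓞 K)ˣ => (u : 𝓞 K)) = Set.univ)
    (hat : ∀ p : LocalOverring O P, Prime p → atomValuations O P p ⊆ {1, 2})
    (hat' : Submodule.IsPrincipal P →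
      ∀ p : LocalOverring O P, Prime p → atomValuations O P p = {1})
    {a : O} (ha : Irreducible a) : primeWeight (Ideal.span {(a : 𝓞 K)}) = 2 := by
  have hc : orderConductor O ≤ P := hf ▸ Ideal.pow_le_self hk.ne'
  have hPt : P ≠ ⊤ := Ideal.IsPrime.ne_top inferInstance
  have ha0 : (a : 𝓞 K) ≠ 0 := fun h => ha.ne_zero (Subtype.ext h)
  have hI0 : Ideal.span {(a : 𝓞 K)} ≠ 0 := by simpa using ha0
  set N := UniqueFactorizationMonoid.normalizedFactors (Ideal.span {(a : 𝓞 K)}) with hN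
  have hprod : N.prod = Ideal.span {(a : 𝓞 K)} :=
    Ideal.prod_normalizedFactors_eq_self hI0
  have hprime : ∀ Q ∈ N, Prime Q := fun Q =>
    UniqueFactorizationMonoid.prime_of_normalized_factor Q
  have hnle : ∀ Q ∈ N, Q ≠ P → ¬ Q ≤ P := fun Q hQ hne hle =>
    have := Ideal.isPrime_of_prime (hprime Q hQ)
    have hmax : Q.IsMaximal := this.isMaximal (hprime Q hQ).ne_zero
    hne (hmax.eq_of_le hPt hle)
  have hsplit : ∀ d : ℕ, d ≠ 0 → (P ^ d).IsPrincipal →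
      (∀ p : LocalOverring O P, Prime p →
        d = 1 ∧ atomValuations O P p = {1} ∨ d = 2 ∧ atomValuations O P p ⊆ {1, 2}) →
      P ^ d ∣ Ideal.span {(a : 𝓞 K)} → Ideal.span {(a : 𝓞 K)} = P ^ d := by
    intro d hd0 hd hat hdvd
    obtain ⟨b, c, hab, hb⟩ := exists_mul_eq_of_mem_pow hirr hP hk hf hu hd hat ha.ne_zero
      (Ideal.dvd_span_singleton.1 hdvd)
    rcases ha.isUnit_or_isUnit hab with h | h
    · have h1 : P ^ d = ⊤ := hb ▸ Ideal.span_singleton_eq_top.2 (h.map O.subtype)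
      exact absurd (top_le_iff.1 (h1 ▸ Ideal.pow_le_self hd0)) hPt
    · rw [← hb, hab]
      exact Ideal.span_singleton_mul_right_unit (h.map O.subtype) (b : 𝓞 K)
  have hone : ∀ Q ∈ N, Submodule.IsPrincipal Q →
      primeWeight (Ideal.span {(a : 𝓞 K)}) = 2 := by
    intro Q hQ hQp
    have hdvd : Q ∣ Ideal.span {(a : 𝓞 K)} := hprod ▸ Multiset.dvd_prod hQ
    have h : Ideal.span {(a : 𝓞 K)} = Q := by
      by_cases hQP : Q = P
      · subst hQP
        simpa using hsplit 1 one_ne_zero (by simpa using hQp)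
          (fun p hp => Or.inl ⟨rfl, hat' hQp p hp⟩) (by simpa using hdvd)
      · exact span_eq_of_irreducible_of_dvd hirr hc hu ha hQp
          (Ideal.isPrime_of_prime (hprime Q hQ)).ne_top (hnle Q hQ hQP) hdvd
    rw [h]
    exact primeWeight_of_prime_of_isPrincipal (hprime Q hQ) hQp
  by_contra hne
  have hnp : ∀ Q ∈ N, ¬ Submodule.IsPrincipal Q := fun Q hQ h => hne (hone Q hQ h)
  -- Two factors on the same side of the condition `= P` have a principal product that exhausts `a 𝓞
  -- K`, which then has weight `1 + 1`. The mixed product of `P` with another prime is not covered.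
  have htwo : ∀ A B N', N = A ::ₘ B ::ₘ N' → ¬ (A = P ↔ B = P) := by
    intro A B N' hAB hiff
    have hA : A ∈ N := by simp [hAB]
    have hB : B ∈ N := by simp [hAB]
    have hpr := isPrincipal_mul_of_card_pic_le_two hpic (hnp A hA) (hnp B hB)
    have hdvd : A * B ∣ Ideal.span {(a : 𝓞 K)} :=
      ⟨N'.prod, by rw [← hprod, hAB, Multiset.prod_cons, Multiset.prod_cons, mul_assoc]⟩
    refine hne ?_
    have h : Ideal.span {(a : 𝓞 K)} = A * B := by
      by_cases hAP : A = P
      · have hBP := hiff.1 hAP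
        subst hAP
        subst hBP
        rw [← pow_two] at hpr hdvd ⊢
        exact hsplit 2 two_ne_zero hpr (fun p hp => Or.inr ⟨rfl, hat p hp⟩) hdvd
      · have hBP : B ≠ P := fun h => hAP (hiff.2 h)
        refine span_eq_of_irreducible_of_dvd hirr hc hu ha hpr ?_ ?_ hdvd
        · intro h
          exact (Ideal.isPrime_of_prime (hprime A hA)).ne_top
            (Ideal.isUnit_iff.1 (isUnit_of_dvd_unit (Dvd.intro B rfl) (Ideal.isUnit_iff.2 h)))
        · intro h
          rcases (Ideal.IsPrime.mul_le inferInstance).1 h with h | h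
          · exact hnle A hA hAP h
          · exact hnle B hB hBP h
    rw [h, primeWeight_mul (hprime A hA).ne_zero (hprime B hB).ne_zero,
      primeWeight_of_prime_of_not_isPrincipal (hprime A hA) (hnp A hA),
      primeWeight_of_prime_of_not_isPrincipal (hprime B hB) (hnp B hB)]
  rcases N.empty_or_exists_mem with h0 | ⟨A, hA⟩
  · rw [h0, Multiset.prod_zero] at hprod
    exact ha.not_isUnit (isUnit_order_of_isUnit hirr hc
      (Ideal.span_singleton_eq_top.1 (hprod.symm.trans Ideal.one_eq_top)))
  obtain ⟨N₁, h₁⟩ := Multiset.exists_cons_of_mem hA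
  rcases N₁.empty_or_exists_mem with rfl | ⟨B, hB⟩
  -- A single prime factor would be generated by `a`, hence principal.
  · refine hnp A hA ⟨a, ?_⟩
    rw [h₁] at hprod
    simpa using hprod
  obtain ⟨N₂, rfl⟩ := Multiset.exists_cons_of_mem hB
  rcases N₂.empty_or_exists_mem with rfl | ⟨C, hC⟩
  · refine hne ?_
    have hB' : B ∈ N := by simp [h₁]
    rw [← hprod, h₁, Multiset.prod_cons, Multiset.prod_cons, Multiset.prod_zero, mul_one,
      primeWeight_mul (hprime A hA).ne_zero (hprime B hB').ne_zero,
      primeWeight_of_prime_of_not_isPrincipal (hprime A hA) (hnp A hA),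
      primeWeight_of_prime_of_not_isPrincipal (hprime B hB') (hnp B hB')]
  obtain ⟨N₃, rfl⟩ := Multiset.exists_cons_of_mem hC
  have hAB := htwo A B _ h₁
  have hAC := htwo A C (B ::ₘ N₃) (by rw [h₁, Multiset.cons_swap B])
  have hBC := htwo B C (A ::ₘ N₃) (by
    rw [h₁, Multiset.cons_swap A, Multiset.cons_swap A])
  -- Pigeonhole: the truth values of `A = P`, `B = P`, `C = P` cannot be pairwise different.
  tauto

/-! ### From weights to lengths. -/

theorem primeWeight_of_prod_irreducible
    (hat : ∀ a : O, Irreducible a → primeWeight (Ideal.span {(a : 𝓞 K)}) = 2)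
    (s : Multiset O) (hs : ∀ b ∈ s, Irreducible b) :
    primeWeight (Ideal.span {((s.prod : O) : 𝓞 K)}) = 2 * s.card := by
  induction s using Multiset.induction_on with
  | empty =>
    have h : Ideal.span {(1 : 𝓞 K)} = 1 :=
      Ideal.span_singleton_one.trans Ideal.one_eq_top.symm
    rw [Multiset.prod_zero, Subring.coe_one, h, primeWeight_one, Multiset.card_zero, mul_zero]
  | cons b s ih =>
    have h0 : s.prod ≠ 0 := Multiset.prod_ne_zero fun h =>
      (hs 0 (Multiset.mem_cons_of_mem h)).ne_zero rfl
    have hb := hs b (Multiset.mem_cons_self b s)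
    have hs0 : ((s.prod : O) : 𝓞 K) ≠ 0 := fun h => h0 (Subtype.ext h)
    have hb0 : (b : 𝓞 K) ≠ 0 := fun h => hb.ne_zero (Subtype.ext h)
    rw [Multiset.prod_cons, Subring.coe_mul, ← Ideal.span_singleton_mul_span_singleton,
      primeWeight_mul (by simpa using hb0) (by simpa using hs0), hat b hb,
      ih fun c hc => hs c (Multiset.mem_cons_of_mem hc), Multiset.card_cons]
    ring

end

theorem proposition4p4 {K : Type*} [Field K] [NumberField K]
    (O : Subring (𝓞 K)) (hO : IsNumberFieldOrder O) (hirr : IsIrreducibleOrder O)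
    (P : Ideal (𝓞 K)) [P.IsPrime] (k : ℕ) (hk : 0 < k) (hf : orderConductor O = P ^ k)
    (h_i : Nat.card (CommRing.Pic (𝓞 K)) ≤ 2)
    (h_ii : (O : Set (𝓞 K)) * Set.range (fun u : (𝓞 K)ˣ => (u : 𝓞 K)) = Set.univ)
    (h_iii : k ≤ 4 ∧ (∀ p : LocalOverring O P, Prime p → atomValuations O P p ⊆ {1, 2}) ∧
      (Submodule.IsPrincipal P →
        k ≤ 2 ∧ ∀ p : LocalOverring O P, Prime p → atomValuations O P p = {1})) :
    IsHalfFactorial O := by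
  intro a ha hnu
  -- If `P = ⊥`, the conductor vanishes and every prime of `O` contains it. By uniqueness the only
  -- prime is `⊥`, so `O` has no nonzero nonunit.
  have hP : P ≠ ⊥ := by
    intro hP
    have hbot : (orderConductor O).comap O.subtype = ⊥ := by
      rw [hf, hP, Ideal.bot_pow hk.ne']
      exact (RingHom.injective_iff_ker_eq_bot _).1 O.subtype_injective
    obtain ⟨m, hm, ham⟩ := exists_max_ideal_of_mem_nonunits hnu
    have hmb : m = ⊥ := hirr.unique ⟨hm.isPrime, hbot ▸ bot_le⟩ ⟨Ideal.isPrime_bot, hbot.le⟩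
    rw [hmb] at ham
    exact ha ham
  have : IsNoetherianRing O := isNoetherianRing_order O
  have hat : ∀ a : O, Irreducible a → primeWeight (Ideal.span {(a : 𝓞 K)}) = 2 := fun _ h =>
    primeWeight_of_irreducible hirr hP hk hf h_i h_ii h_iii.2.1 (fun h => (h_iii.2.2 h).2) h
  obtain ⟨s, hs, hsa, -⟩ := (WfDvdMonoid.not_isUnit_iff_exists_factors_eq a ha).1 hnu
  refine ⟨s.card, ⟨s, hs, hsa, rfl⟩, ?_⟩
  rintro _ ⟨t, ht, hta, rfl⟩
  have h1 := primeWeight_of_prod_irreducible hat s hs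
  have h2 := primeWeight_of_prod_irreducible hat t ht
  rw [hsa] at h1
  rw [hta] at h2
  omega
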